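/- Let $R>0$, identify $\mathfrak{so}(3)\cong\mathfrak{so}(3)^*\cong\mathbb R^3$ in the usual way, and write $\mathbf k=(0,0,1)$. Let $\xi_e=\xi\,\mathbf k$ with $\xi\in\mathbb R$ and $N_\alpha=\mathrm{diag}(J_{N1},J_{N2},J_{N3})$ with $J_{N1}=J_{N2}\neq0$, and set $m_\alpha=-1/(J_{N1}R^2)$. (For $0<\alpha<\pi$, $\cos\alpha\ne0$, this covers the three-vortex data $J_{31}=J_{32}=\frac1{8\pi R^2\cos\alpha}$, $J_{33}=\frac{2\cos^3\alpha+3\cos^2\alpha+2\cos\alpha-1}{8\pi R^2\sin^4\alpha}$, and the four-vortex data $J_{41}=J_{42}=-\frac1{2\pi R^2}\frac{3\cos^2\alpha+\cos\alpha+2}{(1-\cos\alpha)(9\cos^2\alpha+4\cos\alpha+3)}$, $J_{43}=\frac{3\cos^3\alpha+4\cos^2\alpha+3\cos\alpha-2}{12\pi R^2\sin^4\alpha}$.) On $T^*SO(3)\cong SO(3)\times\mathfrak{so}(3)^*\ni(A,\pi)$ (left trivialization), with its canonical symplectic form, consider the left-invariant drift Hamiltonian $H(A,\pi)=\pi\cdot\xi_e+\frac12\pi^tN_\alpha\pi$.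 It is invariant under the normal form symmetry, i.e. the cotangent lift of the action $A\mapsto A\,e^{-\theta\hat{\mathbf k}}$ of the torus generated by $\mathbf k$. For $\sigma\in\mathbb R$ the drift system at $\sigma$ is the Hamiltonian system on the reduced space (the level set at $\sigma$ of the momentum of this action, modulo the action). A point of the reduced space represented by $(A,\pi)$ has location $y=RA\mathbf k$ and momentum $\mu$, the value at $(A,\pi)$ of the momentum map of the left $SO(3)$ action. Then: 1. For every $\sigma$ and every initial state the drift system has exactly one solution defined for all time. The map that sends a solution to its location $y(t)$ is a bijection from the solutions of the drift system at $\sigma$ onto the motions $y:\mathbb R\to\mathbb R^3$ with $|y|=R$ and $$m_\alpha\frac{d^2y}{dt^2}=-m_\alpha\frac{|v|^2}{R}\frac yR+\sigma B\times v,\qquad v=\frac{dy}{dt},\quad B=\frac1{R^3}y,$$ i.e. the motions on the sphere of radius $R$ of a particle of mass $m_\alpha$ and charge $\sigma$ in the field $B$ of a magnetic monopole. 2. Along every solution the momentum is a constant $\Delta\mu$, and the location rotates about $\Delta\mu$ with angular velocity $J_{N1}\Delta\mu$: $y(t)=\exp\bigl(t\,\widehat{J_{N1}\Delta\mu}\bigr)y(0)$,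 where $\hat\eta x=\eta\times x$. 3. If $y(0)=R\mathbf k$, then $v(0)=\frac1{m_\alpha R^2}\,y(0)\times\Delta\mu$ and $\sigma=-\Delta\mu\cdot\mathbf k$; and for every $\Delta\mu\in\mathbb R^3$ there is exactly one state at $\sigma=-\Delta\mu\cdot\mathbf k$ with location $R\mathbf k$ and momentum $\Delta\mu$. -/

import Mathlib

open scoped Matrix

noncomputable section

namespace DriftSystem

/-- `ℝ³`, identified with `so(3)` and with `so(3)*` by the dot product. -/
abbrev Vec3 : Type := Fin 3 → ℝ

abbrev Mat3 : Type := Matrix (Fin 3) (Fin 3) ℝ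

/-- The vector `k = (0,0,1)`. -/
def kvec : Vec3 := ![0, 0, 1]

/-- The isomorphism `ℝ³ ≅ so(3)`, `hat η *ᵥ x = η ⨯₃ x`. -/
def hat (η : Vec3) : Mat3 := !![0, -η 2, η 1; η 2, 0, -η 0; -η 1, η 0, 0]

/-- The inverse of `hat`, extended linearly to all matrices (by zero on symmetric matrices). -/
def vee : Mat3 →ₗ[ℝ] Vec3 where
  toFun M := ![(M 2 1 - M 1 2) / 2, (M 0 2 - M 2 0) / 2, (M 1 0 - M 0 1) / 2]
  map_add' M N := by
    ext i; fin_cases i <;> simp [Matrix.add_apply] <;> ring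
  map_smul' c M := by
    ext i; fin_cases i <;> simp [Matrix.smul_apply] <;> ring

/-! ### The cotangent bundle of `SO(3)` -/

/-- The linear space in which the left trivialised `T*SO(3)` sits: pairs of a `3 × 3` array and a
vector. (Arrays rather than matrices, because the former carry a norm; the choice of the norm
does not matter.) -/
abbrev Ambient : Type := (Fin 3 → Fin 3 → ℝ) × Vec3

/-- The matrix component. -/
def mat (u : Ambient) : Mat3 := Matrix.of u.1

/-- The pair `(A, π)`. -/
def pair (A : Mat3) (π : Vec3) : Ambient := (fun i j => A i j, π)

/-- `T*SO(3)` in the left trivialisation `T*SO(3) ≅ SO(3) × so(3)*`: the pair `(A, π)` stands for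
the covector `α` at `A` with `α (A * hat η) = π ⬝ᵥ η` for all `η`. -/
def TstarSO3 : Set Ambient := {p | mat p ∈ Matrix.specialOrthogonalGroup (Fin 3) ℝ}

/-- The tangent space of `T*SO(3)` at `p = (A, π)`: all `(V, ρ)` with `Aᵀ V` skew. -/
def tangent (p : Ambient) : Set Ambient := {u | (mat p)ᵀ * mat u + (mat u)ᵀ * mat p = 0}

/-- The covector on `SO(3)` for which the point `p = (A, π)` stands: `A * hat η ↦ π ⬝ᵥ η`. -/
def covector (p : Ambient) : Mat3 →ₗ[ℝ] ℝ where
  toFun V := p.2 ⬝ᵥ vee ((mat p)ᵀ * V)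
  map_add' V W := by rw [Matrix.mul_add, map_add, dotProduct_add]
  map_smul' c V := by
    rw [Matrix.mul_smul, map_smul, dotProduct_smul, RingHom.id_apply]

/-- The tautological one-form of `T*SO(3)`: it applies the covector `p` to the image of a tangent
vector under the derivative of the bundle projection `(A, π) ↦ A`. -/
def tautForm (p : Ambient) : Ambient →L[ℝ] ℝ :=
  LinearMap.toContinuousLinearMap
    { toFun := fun u => covector p (mat u)
      map_add' := fun u w => (covector p).map_add (mat u) (mat w)
      map_smul' := fun c u => (covector p).map_smul c (mat u) }

/-- The tautological one-form as a differential form. -/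
def tautOneForm (p : Ambient) : Ambient [⋀^Fin 1]→L[ℝ] ℝ :=
  ContinuousAlternatingMap.ofSubsingleton ℝ Ambient ℝ (0 : Fin 1) (tautForm p)

/-- The canonical symplectic form `ω = -dΘ` (so `ω = dq ∧ dp`), to be evaluated on
tangent vectors of `T*SO(3)`. -/
def omega (p u w : Ambient) : ℝ := -(extDeriv tautOneForm p ![u, w])

/-! ### The drift Hamiltonian -/

/-- The left invariant function `(A, π) ↦ π ⬝ ξ + ½ πᵀ N π`. -/
def driftHamiltonian (ξ : Vec3) (N : Mat3) (p : Ambient) : ℝ :=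
  p.2 ⬝ᵥ ξ + (1 / 2) * (p.2 ⬝ᵥ (N *ᵥ p.2))

/-! ### The normal form symmetry -/

/-- The one parameter group of rotations generated by `k`. -/
def rotZ (θ : ℝ) : Mat3 :=
  !![Real.cos θ, -Real.sin θ, 0; Real.sin θ, Real.cos θ, 0; 0, 0, 1]

/-- The action of the torus on `T*SO(3)` by right multiplication: the cotangent lift of
`A ↦ A (rotZ θ)⁻¹` (see `covector_torusAct`). -/
def torusAct (θ : ℝ) (p : Ambient) : Ambient :=
  pair (mat p * (rotZ θ)ᵀ) (rotZ θ *ᵥ p.2)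

/-- The action is the cotangent lift: pulling the covector `torusAct θ p` back under
`A ↦ A (rotZ θ)⁻¹` gives the covector `p`. -/
theorem covector_torusAct (θ : ℝ) (p : Ambient) (V : Mat3) :
    covector (torusAct θ p) (V * (rotZ θ)ᵀ) = covector p V := by
  have h := Real.sin_sq_add_cos_sq θ
  have key : ∀ (M : Mat3) (x : Vec3),
      (rotZ θ *ᵥ x) ⬝ᵥ vee (rotZ θ * (M * (rotZ θ)ᵀ)) = x ⬝ᵥ vee M := by
    intro M x
    simp only [vee, rotZ, Matrix.mul_apply, Matrix.mulVec, dotProduct, Fin.sum_univ_three,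
      LinearMap.coe_mk, AddHom.coe_mk, Matrix.transpose_apply, Matrix.of_apply,
      Matrix.cons_val', Matrix.cons_val_zero, Matrix.cons_val_one, Matrix.cons_val,
      Matrix.cons_val_fin_one]
    linear_combination (x 0 * (M 2 1 - M 1 2) / 2 + x 1 * (M 0 2 - M 2 0) / 2
      + x 2 * (M 1 0 - M 0 1) / 2) * h
  change (rotZ θ *ᵥ p.2) ⬝ᵥ vee ((mat p * (rotZ θ)ᵀ)ᵀ * (V * (rotZ θ)ᵀ)) = _
  rw [Matrix.transpose_mul, Matrix.transpose_transpose, Matrix.mul_assoc,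
    ← Matrix.mul_assoc (mat p)ᵀ V, key]
  rfl

theorem rotZ_add (θ φ : ℝ) : rotZ (θ + φ) = rotZ θ * rotZ φ := by
  ext i j
  fin_cases i <;> fin_cases j <;>
    simp [rotZ, Matrix.mul_apply, Fin.sum_univ_three, Real.cos_add, Real.sin_add] <;> ring

theorem rotZ_zero : rotZ 0 = 1 := by
  ext i j
  fin_cases i <;> fin_cases j <;> simp [rotZ]

theorem torusAct_zero (p : Ambient) : torusAct 0 p = p := by
  simp only [torusAct, rotZ_zero, Matrix.transpose_one, Matrix.mul_one, Matrix.one_mulVec]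
  rfl

theorem torusAct_add (θ φ : ℝ) (p : Ambient) :
    torusAct (θ + φ) p = torusAct θ (torusAct φ p) := by
  change _ = pair ((mat p * (rotZ φ)ᵀ) * (rotZ θ)ᵀ) (rotZ θ *ᵥ (rotZ φ *ᵥ p.2))
  rw [torusAct, rotZ_add, Matrix.transpose_mul, Matrix.mulVec_mulVec, Matrix.mul_assoc]

/-- The momentum of the torus action: the momentum map of a cotangent lifted action, namely the
tautological one-form applied to the infinitesimal generator. -/
def torusMomentum (p : Ambient) : ℝ := tautForm p (deriv (fun θ : ℝ => torusAct θ p) 0)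

/-- The momentum of the left `SO(3)` action `(A, π) ↦ (B A, π)`; the generator of `ζ` is
`(hat ζ * A, 0)`. -/
def leftMomentum (p : Ambient) : Vec3 :=
  fun i => tautForm p (pair (hat (Pi.single i 1) * mat p) 0)

/-! ### The reduced system -/

/-- The level set of the torus momentum in `T*SO(3)`. -/
def level (σ : ℝ) : Set Ambient := {p | p ∈ TstarSO3 ∧ torusMomentum p = σ}

/-- Its tangent space at `p`. -/
def levelTangent (p : Ambient) : Set Ambient :=
  {u | u ∈ tangent p ∧ fderiv ℝ torusMomentum p u = 0}

/-- The orbit relation of the torus on a momentum level set. -/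
def orbitSetoid (σ : ℝ) : Setoid (level σ) where
  r p q := ∃ θ : ℝ, torusAct θ p.1 = q.1
  iseqv :=
    { refl := fun p => ⟨0, torusAct_zero p.1⟩
      symm := by
        rintro p q ⟨θ, h⟩
        exact ⟨-θ, by rw [← h, ← torusAct_add, neg_add_cancel, torusAct_zero]⟩
      trans := by
        rintro p q r ⟨θ, h⟩ ⟨φ, h'⟩
        exact ⟨φ + θ, by rw [torusAct_add, h, h']⟩ }

/-- The reduced space at momentum `σ`: momentum level set modulo the torus. -/
def ReducedSpace (σ : ℝ) : Type := Quotient (orbitSetoid σ)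

/-- The projection of the level set to the reduced space. -/
def proj (σ : ℝ) (p : level σ) : ReducedSpace σ := Quotient.mk (orbitSetoid σ) p

/-- `γ` solves Hamilton's equation on the reduced space, for the reduced symplectic form (the form
whose pull back to the level set is the restriction of `omega`) and the function induced by `H`:
`γ` is the projection of a differentiable curve `c` in the level set such that
`omega (c', w) = dH w` for all `w` tangent to the level set. So `c` solves the equation only up
to the direction of the torus orbits, which is the kernel of `omega` on the level set. -/
def IsReducedTrajectory (H : Ambient → ℝ) (σ : ℝ) (γ : ℝ → ReducedSpace σ) : Prop :=
  ∃ c : ℝ → level σ, (∀ t, proj σ (c t) = γ t) ∧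
    (∀ t, DifferentiableAt ℝ (fun s => (c s : Ambient)) t) ∧
    ∀ t, ∀ w ∈ levelTangent (c t),
      omega (c t) (deriv (fun s => (c s : Ambient)) t) w = fderiv ℝ H (c t) w

theorem torusAct_mulVec_kvec (θ : ℝ) (p : Ambient) :
    mat (torusAct θ p) *ᵥ kvec = mat p *ᵥ kvec := by
  have : (rotZ θ)ᵀ *ᵥ kvec = kvec := by
    ext i
    fin_cases i <;> simp [rotZ, kvec, Matrix.mulVec, dotProduct, Fin.sum_univ_three]
  change (mat p * (rotZ θ)ᵀ) *ᵥ kvec = _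
  rw [← Matrix.mulVec_mulVec, this]

/-- The location `R A k` on the sphere of radius `R` of a point of the reduced space. -/
def location (R σ : ℝ) : ReducedSpace σ → Vec3 :=
  Quotient.lift (fun p : level σ => R • (mat p.1 *ᵥ kvec)) (by
    rintro p q ⟨θ, h⟩
    simp only [← h, torusAct_mulVec_kvec])

/-- The momentum of the left `SO(3)` action, as a function on the reduced space. -/
def momentum (σ : ℝ) : ReducedSpace σ → Vec3 :=
  Quotient.lift (fun p : level σ => leftMomentum p.1) (by
    rintro p q ⟨θ, h⟩
    funext i
    have h1 : mat q.1 = mat p.1 * (rotZ θ)ᵀ := by rw [← h]; rfl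
    have h2 := covector_torusAct θ p.1 (hat (Pi.single i 1) * mat p.1)
    rw [h, Matrix.mul_assoc, ← h1] at h2
    exact h2.symm)

/-! ### The charged particle -/

/-- The field of the magnetic monopole, `y / R³` at points `y` of the sphere of radius `R`. -/
def monopoleField (R : ℝ) (y : Vec3) : Vec3 := (1 / R ^ 3) • y

/-- `y` is a twice differentiable motion on the sphere of radius `R` with
`m ÿ = -m (|v|² / R) (y / R) + σ B × v`, where `v = ẏ` and `B` is the monopole field. -/
def IsMonopoleMotion (m σ R : ℝ) (y : ℝ → Vec3) : Prop :=
  (∀ t, y t ⬝ᵥ y t = R ^ 2) ∧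
  ∃ v a : ℝ → Vec3, (∀ t, HasDerivAt y (v t) t) ∧ (∀ t, HasDerivAt v (a t) t) ∧
    ∀ t, m • a t = -((m * ((v t ⬝ᵥ v t) / R)) • ((1 / R) • y t))
      + σ • (monopoleField R (y t) ⨯₃ v t)

/-! ### The data of the three and four vortex relative equilibria with opening angle `α` -/

/-- The diagonal `(J₃₁, J₃₂, J₃₃)` of `N_α` for three vortices. -/
def J3 (R α : ℝ) : Vec3 :=
  ![1 / (8 * Real.pi * R ^ 2 * Real.cos α),
    1 / (8 * Real.pi * R ^ 2 * Real.cos α),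
    1 / (8 * Real.pi * R ^ 2 * Real.sin α ^ 4) *
      (2 * Real.cos α ^ 3 + 3 * Real.cos α ^ 2 + 2 * Real.cos α - 1)]

/-- The diagonal `(J₄₁, J₄₂, J₄₃)` of `N_α` for four vortices. -/
def J4 (R α : ℝ) : Vec3 :=
  ![-(1 / (2 * Real.pi * R ^ 2)) * ((3 * Real.cos α ^ 2 + Real.cos α + 2) /
      ((1 - Real.cos α) * (9 * Real.cos α ^ 2 + 4 * Real.cos α + 3))),
    -(1 / (2 * Real.pi * R ^ 2)) * ((3 * Real.cos α ^ 2 + Real.cos α + 2) /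
      ((1 - Real.cos α) * (9 * Real.cos α ^ 2 + 4 * Real.cos α + 3))),
    1 / (12 * Real.pi * R ^ 2 * Real.sin α ^ 4) *
      (3 * Real.cos α ^ 3 + 4 * Real.cos α ^ 2 + 3 * Real.cos α - 2)]

end DriftSystem

end

open DriftSystem

/-!
In the left trivialisation, with a velocity at `(A, π)` written `(A * hat η, ρ)`, the symplectic
form is `τ ⬝ η - ρ ⬝ ζ + π ⬝ (η × ζ)` (`omega_pair`), the torus momentum is `-π 2`
(`torusMomentum_of_mem`) and the momentum of the left action is `μ = A π` (`leftMomentum_of_mem`).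
Since `J 0 = J 1`, Hamilton's equation tested against the tangent space of the level set says that
`η` equals `J 0 • π` up to a multiple of `k`, and that `ρ = π × η` (`hamilton_iff`). Hence `μ` is
constant, and the location `y = R A k`, which does not see the multiple of `k`, satisfies
`y' = J 0 • μ × y` (`IsReducedTrajectory.hasDerivAt`); so `y` rotates about `μ`
(`eq_exp_mulVec_of_hasDerivAt`).

Location and momentum are coordinates on the reduced space: they separate points because the
stabiliser of `k` in `SO(3)` is the torus (`eq_of_location_eq_of_momentum_eq`), and their only
constraints are `|y| = R` and `μ ⬝ y = -R σ`, because `SO(3)` acts transitively on the sphere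
(`exists_state`). This gives existence and uniqueness of the trajectories.

Finally `v = J 0 • μ × y` and `μ ⬝ y = -R σ` are solved by `μ = -m y × v - (σ / R) y`
(`momentum_eq_of_velocity`), minus the sum of the angular momenta of the particle and of the
electromagnetic field. Uniform rotation about `μ` satisfies the equation of the charged particle
(`isMonopoleMotion_of_hasDerivAt`), and conversely the particle conserves this vector
(`IsMonopoleMotion.exists_hasDerivAt`); so both systems have the same motions.
-/

namespace DriftSystem

/-! ### Rotations of `ℝ³` -/

theorem hat_mulVec (η x : Vec3) : hat η *ᵥ x = η ⨯₃ x := by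
  ext i
  fin_cases i <;> simp [hat, cross_apply, Matrix.mulVec, dotProduct, Fin.sum_univ_three] <;> ring

theorem hat_transpose (η : Vec3) : (hat η)ᵀ = -hat η := by
  ext i j
  fin_cases i <;> fin_cases j <;> simp [hat]

theorem vee_hat (η : Vec3) : vee (hat η) = η := by
  ext i
  fin_cases i <;> simp [hat, vee]

theorem hat_vee {M : Mat3} (hM : M + Mᵀ = 0) : hat (vee M) = M := by
  have h : ∀ i j, M i j + M j i = 0 := fun i j => congrFun (congrFun hM i) j
  have h0 := h 0 0
  have h1 := h 1 1
  have h2 := h 2 2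
  have h3 := h 0 1
  have h4 := h 0 2
  have h5 := h 1 2
  ext i j
  fin_cases i <;> fin_cases j <;> simp [hat, vee] <;> linarith

/-- Pulling the cross product with `M *ᵥ η` back by `M` rescales the cross product with `η` by
`det M`; this is the invariance of the volume form up to the determinant. -/
theorem transpose_mul_hat_mul (M : Mat3) (η : Vec3) :
    Mᵀ * hat (M *ᵥ η) * M = M.det • hat η := by
  ext i j
  fin_cases i <;> fin_cases j <;>
    simp [hat, Matrix.mul_apply, Matrix.mulVec, dotProduct, Fin.sum_univ_three,
      Matrix.det_fin_three] <;> ring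

theorem hat_mul_hat_sub (η ζ : Vec3) : hat η * hat ζ - hat ζ * hat η = hat (η ⨯₃ ζ) := by
  ext i j
  fin_cases i <;> fin_cases j <;>
    simp [hat, cross_apply] <;> ring

theorem mulVec_kvec (A : Mat3) (i : Fin 3) : (A *ᵥ kvec) i = A i 2 := by
  simp [kvec, Matrix.mulVec, dotProduct, Fin.sum_univ_three]

theorem dotProduct_kvec (x : Vec3) : x ⬝ᵥ kvec = x 2 := by
  simp [kvec, dotProduct, Fin.sum_univ_three]

section Rotation

variable {A : Mat3}

theorem transpose_mul_self_of_mem (hA : A ∈ Matrix.specialOrthogonalGroup (Fin 3) ℝ) :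
    Aᵀ * A = 1 :=
  (Matrix.mem_orthogonalGroup_iff' _ _).1 (Matrix.mem_specialOrthogonalGroup_iff.1 hA).1

theorem mul_transpose_self_of_mem (hA : A ∈ Matrix.specialOrthogonalGroup (Fin 3) ℝ) :
    A * Aᵀ = 1 :=
  (Matrix.mem_orthogonalGroup_iff _ _).1 (Matrix.mem_specialOrthogonalGroup_iff.1 hA).1

theorem mem_of_transpose_mul_self (h : Aᵀ * A = 1) (hdet : A.det = 1) :
    A ∈ Matrix.specialOrthogonalGroup (Fin 3) ℝ :=
  Matrix.mem_specialOrthogonalGroup_iff.2 ⟨(Matrix.mem_orthogonalGroup_iff' _ _).2 h, hdet⟩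

theorem transpose_mem (hA : A ∈ Matrix.specialOrthogonalGroup (Fin 3) ℝ) :
    Aᵀ ∈ Matrix.specialOrthogonalGroup (Fin 3) ℝ :=
  mem_of_transpose_mul_self (by
    rw [Matrix.transpose_transpose]; exact mul_transpose_self_of_mem hA) (by
    rw [Matrix.det_transpose]; exact (Matrix.mem_specialOrthogonalGroup_iff.1 hA).2)

theorem transpose_hat_conj (hA : A ∈ Matrix.specialOrthogonalGroup (Fin 3) ℝ) (η : Vec3) :
    Aᵀ * hat η * A = hat (Aᵀ *ᵥ η) := by
  have h := transpose_mul_hat_mul A (Aᵀ *ᵥ η)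
  rwa [(Matrix.mem_specialOrthogonalGroup_iff.1 hA).2, one_smul, Matrix.mulVec_mulVec,
    mul_transpose_self_of_mem hA, Matrix.one_mulVec] at h

theorem hat_mul_of_mem (hA : A ∈ Matrix.specialOrthogonalGroup (Fin 3) ℝ) (η : Vec3) :
    hat η * A = A * hat (Aᵀ *ᵥ η) := by
  rw [← transpose_hat_conj hA, ← Matrix.mul_assoc, ← Matrix.mul_assoc,
    mul_transpose_self_of_mem hA, Matrix.one_mul]

theorem mulVec_cross (hA : A ∈ Matrix.specialOrthogonalGroup (Fin 3) ℝ) (x y : Vec3) :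
    A *ᵥ (x ⨯₃ y) = (A *ᵥ x) ⨯₃ (A *ᵥ y) := by
  rw [← hat_mulVec (A *ᵥ x), Matrix.mulVec_mulVec, hat_mul_of_mem hA, Matrix.mulVec_mulVec,
    transpose_mul_self_of_mem hA, Matrix.one_mulVec, ← Matrix.mulVec_mulVec, hat_mulVec]

theorem mulVec_dotProduct_mulVec (hA : A ∈ Matrix.specialOrthogonalGroup (Fin 3) ℝ) (x y : Vec3) :
    (A *ᵥ x) ⬝ᵥ (A *ᵥ y) = x ⬝ᵥ y := by
  rw [Matrix.dotProduct_mulVec, ← Matrix.mulVec_transpose, Matrix.mulVec_mulVec,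
    transpose_mul_self_of_mem hA, Matrix.one_mulVec]

/-- The stabiliser of `k` in `SO(3)` is the torus of rotations about `k`. -/
theorem exists_eq_rotZ (hA : A ∈ Matrix.specialOrthogonalGroup (Fin 3) ℝ)
    (hk : A *ᵥ kvec = kvec) : ∃ θ, A = rotZ θ := by
  have hdet := (Matrix.mem_specialOrthogonalGroup_iff.1 hA).2
  have e : ∀ i j, (Aᵀ * A) i j = (1 : Mat3) i j := fun i j => by
    rw [transpose_mul_self_of_mem hA]
  have e22 : (A * Aᵀ) 2 2 = (1 : Mat3) 2 2 := by rw [mul_transpose_self_of_mem hA]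
  have k0 : A 0 2 = 0 := by rw [← mulVec_kvec A, hk]; rfl
  have k1 : A 1 2 = 0 := by rw [← mulVec_kvec A, hk]; rfl
  have k2 : A 2 2 = 1 := by rw [← mulVec_kvec A, hk]; rfl
  have e00 := e 0 0
  have e01 := e 0 1
  simp only [Matrix.mul_apply, Matrix.transpose_apply, Fin.sum_univ_three, Matrix.one_apply_eq,
    k2] at e22 e00
  simp only [Matrix.mul_apply, Matrix.transpose_apply, Fin.sum_univ_three, ne_eq, zero_ne_one,
    not_false_eq_true, Matrix.one_apply_ne] at e01
  have r0 : A 2 0 = 0 := by nlinarith [sq_nonneg (A 2 0), sq_nonneg (A 2 1)]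
  have r1 : A 2 1 = 0 := by nlinarith [sq_nonneg (A 2 0), sq_nonneg (A 2 1)]
  rw [Matrix.det_fin_three] at hdet
  simp only [k0, k1, k2, r0, r1] at hdet e00 e01
  have n0 : A 1 1 = A 0 0 := by
    linear_combination A 0 0 * hdet + A 1 0 * e01 - A 1 1 * e00
  have n1 : A 0 1 = -A 1 0 := by
    linear_combination A 0 0 * e01 - A 1 0 * hdet - A 0 1 * e00
  have hn : ‖(⟨A 0 0, A 1 0⟩ : ℂ)‖ = 1 := by
    rw [Complex.norm_def, Complex.normSq_mk, Real.sqrt_eq_one]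
    linarith
  have hc := Complex.norm_mul_cos_arg ⟨A 0 0, A 1 0⟩
  have hs := Complex.norm_mul_sin_arg ⟨A 0 0, A 1 0⟩
  rw [hn, one_mul] at hc hs
  refine ⟨Complex.arg ⟨A 0 0, A 1 0⟩, ?_⟩
  ext i j
  fin_cases i <;> fin_cases j <;> simp [rotZ, hc, hs, k0, k1, k2, r0, r1, n0, n1]

end Rotation

/-- `SO(3)` acts transitively on the unit sphere. -/
theorem exists_mem_mulVec_kvec {n : Vec3} (hn : n ⬝ᵥ n = 1) :
    ∃ A ∈ Matrix.specialOrthogonalGroup (Fin 3) ℝ, A *ᵥ kvec = n := by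
  have h : n 0 * n 0 + n 1 * n 1 + n 2 * n 2 = 1 := by
    rwa [dotProduct, Fin.sum_univ_three] at hn
  by_cases h2 : 1 + n 2 = 0
  · have e2 : n 2 = -1 := by linarith
    have e0 : n 0 = 0 := by nlinarith [sq_nonneg (n 0), sq_nonneg (n 1)]
    have e1 : n 1 = 0 := by nlinarith [sq_nonneg (n 0), sq_nonneg (n 1)]
    refine ⟨!![1, 0, 0; 0, -1, 0; 0, 0, -1], mem_of_transpose_mul_self ?_ ?_, ?_⟩
    · ext i j
      fin_cases i <;> fin_cases j <;> simp [Matrix.mul_apply, Fin.sum_univ_three]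
    · simp [Matrix.det_fin_three]
    · ext i
      rw [mulVec_kvec]
      fin_cases i <;> simp [e0, e1, e2]
  · -- the rotation by the smallest angle that takes `k` to `n`
    obtain ⟨s, hs⟩ : ∃ s, s * (1 + n 2) = 1 := ⟨(1 + n 2)⁻¹, inv_mul_cancel₀ h2⟩
    refine ⟨!![1 - s * n 0 * n 0, -(s * n 0 * n 1), n 0;
      -(s * n 0 * n 1), 1 - s * n 1 * n 1, n 1; -n 0, -n 1, n 2],
      mem_of_transpose_mul_self ?_ ?_, ?_⟩
    · -- for `a, b` among `n 0, n 1` these say that the columns are orthonormal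
      have c : ∀ a b : ℝ, s * s * a * b * (n 0 * n 0 + n 1 * n 1) - 2 * s * a * b + a * b = 0 := by
        intro a b
        linear_combination s * s * a * b * h + (a * b * (s * (1 - n 2) - 1)) * hs
      have d : ∀ a : ℝ, a * (1 - s * (n 0 * n 0 + n 1 * n 1)) - a * n 2 = 0 := by
        intro a
        linear_combination -s * a * h - a * (1 - n 2) * hs
      ext i j
      fin_cases i <;> fin_cases j <;> simp [Matrix.mul_apply, Fin.sum_univ_three]
      · linear_combination c (n 0) (n 0)
      · linear_combination c (n 0) (n 1)
      · linear_combination d (n 0)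
      · linear_combination c (n 0) (n 1)
      · linear_combination c (n 1) (n 1)
      · linear_combination d (n 1)
      · linear_combination d (n 0)
      · linear_combination d (n 1)
      · linear_combination h
    · simp [Matrix.det_fin_three]
      linear_combination (1 - s * n 2) * h + (n 2 - 1) * n 2 * hs
    · ext i
      rw [mulVec_kvec]
      fin_cases i <;> simp

/-! ### Derivatives of the tautological form -/

theorem tautForm_apply (p u : Ambient) : tautForm p u = p.2 ⬝ᵥ vee ((mat p)ᵀ * mat u) := rfl

theorem differentiable_tautForm : Differentiable ℝ tautForm := by
  have h : ContDiff ℝ 1 tautForm := by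
    refine contDiff_clm_apply_iff.2 fun u => ?_
    simp only [tautForm_apply, mat, vee, LinearMap.coe_mk, AddHom.coe_mk, dotProduct,
      Fin.sum_univ_three, Matrix.mul_apply, Matrix.transpose_apply, Matrix.of_apply,
      Matrix.cons_val_zero, Matrix.cons_val_one, Matrix.cons_val]
    fun_prop
  exact h.differentiable one_ne_zero

theorem differentiable_tautForm_apply (u : Ambient) : Differentiable ℝ fun p => tautForm p u :=
  differentiable_tautForm.clm_apply (differentiable_const u)

/-- The directional derivative of a function that is cubic along the line through `p` in the
direction `u`; all functions on `Ambient` that have to be differentiated are of this kind. -/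
theorem fderiv_eq_of_line {f : Ambient → ℝ} {p u : Ambient} {a b c : ℝ}
    (hf : DifferentiableAt ℝ f p)
    (h : ∀ t : ℝ, f (p + t • u) = f p + t * a + t ^ 2 * b + t ^ 3 * c) : fderiv ℝ f p u = a := by
  rw [← hf.lineDeriv_eq_fderiv, lineDeriv]
  simp only [h]
  have : HasDerivAt (fun t : ℝ => f p + t * a + t ^ 2 * b + t ^ 3 * c) a 0 := by
    have h1 := (hasDerivAt_id (0:ℝ)).mul_const a
    have h2 := ((hasDerivAt_id (0:ℝ)).pow 2).mul_const b
    have h3 := ((hasDerivAt_id (0:ℝ)).pow 3).mul_const c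
    exact (((h1.const_add (f p)).add h2).add h3).congr_deriv (by simp)
  exact this.deriv

theorem fderiv_tautForm_apply (p u w : Ambient) :
    fderiv ℝ (fun q => tautForm q w) p u =
      u.2 ⬝ᵥ vee ((mat p)ᵀ * mat w) + p.2 ⬝ᵥ vee ((mat u)ᵀ * mat w) := by
  refine fderiv_eq_of_line (b := u.2 ⬝ᵥ vee ((mat u)ᵀ * mat w)) (c := 0)
    (differentiable_tautForm_apply w p) fun t => ?_
  have hm : mat (p + t • u) = mat p + t • mat u := rfl
  have h2 : (p + t • u).2 = p.2 + t • u.2 := rfl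
  simp only [tautForm_apply, hm, h2, Matrix.transpose_add, Matrix.transpose_smul, Matrix.add_mul,
    Matrix.smul_mul, map_add, map_smul, dotProduct_add, add_dotProduct, dotProduct_smul,
    smul_dotProduct, smul_eq_mul]
  ring

/-- Cartan's formula `dΘ (u, w) = D_u Θ (w) - D_w Θ (u)` in coordinates. -/
theorem omega_apply (p u w : Ambient) :
    omega p u w =
      w.2 ⬝ᵥ vee ((mat p)ᵀ * mat u) - u.2 ⬝ᵥ vee ((mat p)ᵀ * mat w)
        - p.2 ⬝ᵥ vee ((mat u)ᵀ * mat w - (mat w)ᵀ * mat u) := by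
  have hd : DifferentiableAt ℝ tautOneForm p :=
    (ContinuousAlternatingMap.ofSubsingletonLIE (𝕜 := ℝ) (E := Ambient) (F := ℝ)
      (0 : Fin 1)).toContinuousLinearEquiv.differentiable.comp differentiable_tautForm p
  rw [omega, extDeriv_apply hd]
  have e : ∀ x : Ambient, ∀ v : Fin 1 → Ambient, tautOneForm x v = tautForm x (v 0) :=
    fun _ _ => rfl
  simp only [e, Fin.removeNth]
  simp [fderiv_tautForm_apply, Fin.succAbove]
  ring

/-! ### Momentum maps and the symplectic form in the left trivialisation -/

theorem mat_pair (A : Mat3) (π : Vec3) : mat (pair A π) = A := rfl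

theorem hasDerivAt_rotZ_apply_zero (i j : Fin 3) :
    HasDerivAt (fun θ => rotZ θ i j) (hat kvec i j) 0 := by
  have hs : HasDerivAt Real.sin 1 0 := by simpa using Real.hasDerivAt_sin 0
  have hc : HasDerivAt Real.cos 0 0 := by simpa using Real.hasDerivAt_cos 0
  have hn : HasDerivAt (fun θ => -Real.sin θ) (-1) 0 := hs.neg
  fin_cases i <;> fin_cases j <;>
    simp [rotZ, hat, kvec, hs, hc, hn, hasDerivAt_const]

theorem deriv_torusAct_zero (p : Ambient) :
    deriv (fun θ : ℝ => torusAct θ p) 0 = pair (-(mat p * hat kvec)) (hat kvec *ᵥ p.2) := by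
  refine HasDerivAt.deriv (HasDerivAt.prodMk ?_ ?_)
  · refine hasDerivAt_pi.2 fun i => hasDerivAt_pi.2 fun j => ?_
    have h : HasDerivAt (fun θ => ∑ k, mat p i k * rotZ θ j k)
        (∑ k, mat p i k * hat kvec j k) 0 :=
      HasDerivAt.fun_sum fun k _ => (hasDerivAt_rotZ_apply_zero j k).const_mul _
    refine h.congr_deriv ?_
    have e : ∀ j k, hat kvec j k = -hat kvec k j := fun j k => by
      rw [← Matrix.neg_apply, ← hat_transpose, Matrix.transpose_apply]
    simp only [e j, mul_neg, Finset.sum_neg_distrib]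
    rfl
  · refine hasDerivAt_pi.2 fun i => ?_
    have h : HasDerivAt (fun θ => ∑ k, rotZ θ i k * p.2 k) (∑ k, hat kvec i k * p.2 k) 0 :=
      HasDerivAt.fun_sum fun k _ => (hasDerivAt_rotZ_apply_zero i k).mul_const _
    exact h

theorem torusMomentum_eq (p : Ambient) :
    torusMomentum p = -(p.2 ⬝ᵥ vee ((mat p)ᵀ * mat p * hat kvec)) := by
  rw [torusMomentum, deriv_torusAct_zero, tautForm_apply, mat_pair, Matrix.mul_neg, map_neg,
    dotProduct_neg, Matrix.mul_assoc]

/-- On `T*SO(3)` the torus momentum is minus the third body component of the momentum: the torus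
acts by inverse rotations from the right. -/
theorem torusMomentum_of_mem {p : Ambient} (hp : p ∈ TstarSO3) : torusMomentum p = -p.2 2 := by
  rw [torusMomentum_eq, transpose_mul_self_of_mem hp, Matrix.one_mul, vee_hat]
  simp [kvec, dotProduct, Fin.sum_univ_three]

theorem fderiv_torusMomentum {p u : Ambient} (hp : p ∈ TstarSO3) (hu : u ∈ tangent p) :
    fderiv ℝ torusMomentum p u = -u.2 2 := by
  have hd : Differentiable ℝ torusMomentum := by
    have : torusMomentum = fun p => -(p.2 ⬝ᵥ vee ((mat p)ᵀ * mat p * hat kvec)) :=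
      funext torusMomentum_eq
    rw [this]
    simp only [mat, vee, LinearMap.coe_mk, AddHom.coe_mk, dotProduct,
      Fin.sum_univ_three, Matrix.mul_apply, Matrix.transpose_apply, Matrix.of_apply,
      Matrix.cons_val_zero, Matrix.cons_val_one, Matrix.cons_val]
    fun_prop
  refine fderiv_eq_of_line (b := -(p.2 ⬝ᵥ vee ((mat u)ᵀ * mat u * hat kvec)))
    (c := -(u.2 ⬝ᵥ vee ((mat u)ᵀ * mat u * hat kvec))) (hd p) fun t => ?_
  -- the first order variation of `Aᵀ A` vanishes along tangent vectors
  have hm : (mat (p + t • u))ᵀ * mat (p + t • u) = 1 + t ^ 2 • ((mat u)ᵀ * mat u) := by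
    have h0 : mat (p + t • u) = mat p + t • mat u := rfl
    have h1 := transpose_mul_self_of_mem hp
    have h2 : (mat p)ᵀ * mat u + (mat u)ᵀ * mat p = 0 := hu
    rw [h0, Matrix.transpose_add, Matrix.transpose_smul, Matrix.add_mul, Matrix.mul_add,
      Matrix.mul_add, h1, Matrix.smul_mul, Matrix.smul_mul, Matrix.mul_smul, Matrix.mul_smul,
      eq_neg_of_add_eq_zero_left h2, smul_smul, pow_two, smul_neg]
    abel
  have h2 : (p + t • u).2 = p.2 + t • u.2 := rfl
  rw [torusMomentum_eq, torusMomentum_of_mem hp, hm, h2]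
  simp only [Matrix.add_mul, Matrix.one_mul, Matrix.smul_mul, map_add, map_smul, vee_hat,
    dotProduct_add, add_dotProduct, dotProduct_smul, smul_dotProduct, smul_eq_mul, dotProduct_kvec]
  ring

/-- The left momentum is the momentum in the spatial frame. -/
theorem leftMomentum_of_mem {p : Ambient} (hp : p ∈ TstarSO3) :
    leftMomentum p = mat p *ᵥ p.2 := by
  funext i
  rw [leftMomentum, tautForm_apply, mat_pair, ← Matrix.mul_assoc, transpose_hat_conj hp, vee_hat,
    Matrix.dotProduct_mulVec, ← Matrix.mulVec_transpose, Matrix.transpose_transpose,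
    dotProduct_single_one]

/-- On `T*SO(3)`, in terms of body angular velocities, the symplectic form is the canonical pairing
plus the Lie-Poisson term; the latter comes from the non-commutativity of `so(3)`. -/
theorem omega_pair {p : Ambient} (hp : p ∈ TstarSO3) (η ρ ζ τ : Vec3) :
    omega p (pair (mat p * hat η) ρ) (pair (mat p * hat ζ) τ) =
      τ ⬝ᵥ η - ρ ⬝ᵥ ζ + p.2 ⬝ᵥ (η ⨯₃ ζ) := by
  have h : ∀ x y : Vec3, (mat p * hat x)ᵀ * (mat p * hat y) = -(hat x * hat y) := fun x y => by
    rw [Matrix.transpose_mul, hat_transpose, Matrix.mul_assoc, ← Matrix.mul_assoc (mat p)ᵀ,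
      transpose_mul_self_of_mem hp, Matrix.one_mul, Matrix.neg_mul]
  have h' : ∀ x : Vec3, (mat p)ᵀ * (mat p * hat x) = hat x := fun x => by
    rw [← Matrix.mul_assoc, transpose_mul_self_of_mem hp, Matrix.one_mul]
  have e : -(hat η * hat ζ) - -(hat ζ * hat η) = -hat (η ⨯₃ ζ) := by
    rw [← hat_mul_hat_sub]; abel
  rw [omega_apply, mat_pair, mat_pair, h, h, h', h', e, map_neg, vee_hat, vee_hat, vee_hat,
    dotProduct_neg, sub_neg_eq_add]
  rfl

theorem pair_mem_tangent {p : Ambient} (hp : p ∈ TstarSO3) (η ρ : Vec3) :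
    pair (mat p * hat η) ρ ∈ tangent p := by
  change (mat p)ᵀ * (mat p * hat η) + (mat p * hat η)ᵀ * mat p = 0
  rw [Matrix.transpose_mul, Matrix.mul_assoc, ← Matrix.mul_assoc, transpose_mul_self_of_mem hp,
    hat_transpose, Matrix.one_mul, Matrix.mul_one, add_neg_cancel]

theorem exists_eq_pair_of_mem_tangent {p u : Ambient} (hp : p ∈ TstarSO3) (hu : u ∈ tangent p) :
    ∃ η, u = pair (mat p * hat η) u.2 := by
  have hu' : (mat p)ᵀ * mat u + ((mat p)ᵀ * mat u)ᵀ = 0 := by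
    rw [Matrix.transpose_mul, Matrix.transpose_transpose]
    exact hu
  refine ⟨vee ((mat p)ᵀ * mat u), ?_⟩
  rw [hat_vee hu', ← Matrix.mul_assoc, mul_transpose_self_of_mem hp, Matrix.one_mul]
  rfl

/-! ### Hamilton's equation on the level set -/

theorem fderiv_driftHamiltonian (ξ : ℝ) (J : Vec3) (p w : Ambient) :
    fderiv ℝ (driftHamiltonian (ξ • kvec) (Matrix.diagonal J)) p w =
      ξ * w.2 2 + (J 0 * p.2 0 * w.2 0 + J 1 * p.2 1 * w.2 1 + J 2 * p.2 2 * w.2 2) := by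
  have e : driftHamiltonian (ξ • kvec) (Matrix.diagonal J) = fun p =>
      ξ * p.2 2 + (1 / 2) * (J 0 * p.2 0 ^ 2 + J 1 * p.2 1 ^ 2 + J 2 * p.2 2 ^ 2) := by
    funext p
    simp [driftHamiltonian, kvec, dotProduct, Fin.sum_univ_three, Matrix.mulVec_diagonal]
    ring
  have hd : Differentiable ℝ (driftHamiltonian (ξ • kvec) (Matrix.diagonal J)) := by
    rw [e]; fun_prop
  refine fderiv_eq_of_line
    (b := (1 / 2) * (J 0 * w.2 0 ^ 2 + J 1 * w.2 1 ^ 2 + J 2 * w.2 2 ^ 2)) (c := 0)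
    (hd p) fun t => ?_
  simp only [e, Prod.snd_add, Prod.smul_snd, Pi.add_apply, Pi.smul_apply, smul_eq_mul]
  ring

/-- Hamilton's equation on the level set: with `u = (A * hat η, ρ)` the angular velocity `η` is
`J 0 • π` up to a multiple of `k`, the direction of the torus orbits, and `π` moves by
`π ⨯₃ η`. -/
theorem hamilton_iff {ξ : ℝ} {J : Vec3} (hJ : J 0 = J 1) {p : Ambient} (hp : p ∈ TstarSO3)
    (η ρ : Vec3) :
    (∀ w ∈ levelTangent p, omega p (pair (mat p * hat η) ρ) w =
      fderiv ℝ (driftHamiltonian (ξ • kvec) (Matrix.diagonal J)) p w) ↔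
    η ⨯₃ kvec = J 0 • (p.2 ⨯₃ kvec) ∧ ρ = p.2 ⨯₃ η := by
  have key : ∀ ζ τ : Vec3, omega p (pair (mat p * hat η) ρ) (pair (mat p * hat ζ) τ) -
      fderiv ℝ (driftHamiltonian (ξ • kvec) (Matrix.diagonal J)) p (pair (mat p * hat ζ) τ) =
      τ 0 * (η 0 - J 0 * p.2 0) + τ 1 * (η 1 - J 0 * p.2 1)
        + τ 2 * (η 2 - ξ - J 2 * p.2 2) - (ρ - p.2 ⨯₃ η) ⬝ᵥ ζ := by
    intro ζ τ
    rw [omega_pair hp, fderiv_driftHamiltonian, ← hJ]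
    simp [pair, cross_apply, dotProduct, Fin.sum_univ_three]
    ring
  have hmem : ∀ ζ τ : Vec3, τ 2 = 0 → pair (mat p * hat ζ) τ ∈ levelTangent p := fun ζ τ h =>
    ⟨pair_mem_tangent hp ζ τ, by
      rw [fderiv_torusMomentum hp (pair_mem_tangent hp ζ τ)]
      simpa [pair] using h⟩
  constructor
  -- test vectors with `τ 2 = 0` and `ζ` arbitrary leave only the third component of `η` free
  · intro h
    have hz : ∀ ζ τ : Vec3, τ 2 = 0 → _ := fun ζ τ h2 =>
      (key ζ τ).symm.trans (sub_eq_zero.2 (h _ (hmem ζ τ h2)))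
    have a0 : η 0 = J 0 * p.2 0 := by
      simpa [sub_eq_zero] using hz 0 (Pi.single 0 1) (by simp)
    have a1 : η 1 = J 0 * p.2 1 := by
      simpa [sub_eq_zero] using hz 0 (Pi.single 1 1) (by simp)
    refine ⟨?_, ?_⟩
    · ext i
      fin_cases i <;> simp [cross_apply, kvec, a0, a1]
    · ext i
      have := hz (Pi.single i 1) 0 rfl
      rw [dotProduct_single_one] at this
      exact (by simpa [sub_eq_zero] using this : _ = ρ i).symm
  · rintro ⟨hη, hρ⟩ w ⟨hw, hw'⟩
    obtain ⟨ζ, e⟩ := exists_eq_pair_of_mem_tangent hp hw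
    have h2 : w.2 2 = 0 := by
      rw [fderiv_torusMomentum hp hw] at hw'
      simpa using hw'
    have a0 : η 0 = J 0 * p.2 0 := by simpa [cross_apply, kvec] using congrFun hη 1
    have a1 : η 1 = J 0 * p.2 1 := by simpa [cross_apply, kvec] using congrFun hη 0
    rw [e, ← sub_eq_zero, key, h2, hρ, a0, a1]
    simp

/-! ### Differentiable curves in `ℝ³` and in `T*SO(3)` -/

theorem hasDerivAt_exp_smul_apply (X : Mat3) (i j : Fin 3) (t : ℝ) :
    HasDerivAt (fun s : ℝ => NormedSpace.exp (s • X) i j)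
      ((X * NormedSpace.exp (t • X)) i j) t := by
  let _ : NormedRing Mat3 := Matrix.linftyOpNormedRing
  let _ : NormedAlgebra ℝ Mat3 := Matrix.linftyOpNormedAlgebra
  have h : HasDerivAt (fun s : ℝ => NormedSpace.exp (s • X)) (X * NormedSpace.exp (t • X)) t :=
    hasDerivAt_exp_smul_const' X t
  exact (LinearMap.toContinuousLinearMap
    (Matrix.entryLinearMap ℝ ℝ i j)).hasFDerivAt.comp_hasDerivAt t h

theorem exp_hat_mem (η : Vec3) :
    NormedSpace.exp (hat η) ∈ Matrix.specialOrthogonalGroup (Fin 3) ℝ := by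
  have h : ∀ ζ : Vec3, (NormedSpace.exp (hat ζ))ᵀ * NormedSpace.exp (hat ζ) = 1 := fun ζ => by
    rw [← Matrix.exp_transpose, hat_transpose, Matrix.exp_neg]
    exact Matrix.nonsing_inv_mul _ ((Matrix.isUnit_iff_isUnit_det _).1 (Matrix.isUnit_exp _))
  refine mem_of_transpose_mul_self (h η) ?_
  -- the determinant is `±1`, and it is the square of the determinant of `exp (hat (η / 2))`
  have e : hat η = hat ((1 / 2 : ℝ) • η) + hat ((1 / 2 : ℝ) • η) := by
    ext i j
    fin_cases i <;> fin_cases j <;> simp [hat] <;> ring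
  have h2 := congrArg Matrix.det (h ((1 / 2 : ℝ) • η))
  rw [Matrix.det_mul, Matrix.det_transpose, Matrix.det_one] at h2
  rw [e, Matrix.exp_add_of_commute _ _ (Commute.refl _), Matrix.det_mul, h2]

theorem smul_hat (t : ℝ) (η : Vec3) : t • hat η = hat (t • η) := by
  ext i j
  fin_cases i <;> fin_cases j <;> simp [hat]

theorem hasDerivAt_exp_mulVec (ω x : Vec3) (t : ℝ) :
    HasDerivAt (fun s : ℝ => NormedSpace.exp (s • hat ω) *ᵥ x)
      (ω ⨯₃ (NormedSpace.exp (t • hat ω) *ᵥ x)) t := by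
  rw [← hat_mulVec, Matrix.mulVec_mulVec]
  refine hasDerivAt_pi.2 fun i => ?_
  have h : HasDerivAt (fun s : ℝ => ∑ k, NormedSpace.exp (s • hat ω) i k * x k)
      (∑ k, (hat ω * NormedSpace.exp (t • hat ω)) i k * x k) t :=
    HasDerivAt.fun_sum fun k _ => (hasDerivAt_exp_smul_apply _ i k t).mul_const _
  exact h

theorem hasDerivAt_dotProduct {x y : ℝ → Vec3} {x' y' : Vec3} {t : ℝ} (hx : HasDerivAt x x' t)
    (hy : HasDerivAt y y' t) :
    HasDerivAt (fun s => x s ⬝ᵥ y s) (x' ⬝ᵥ y t + x t ⬝ᵥ y') t := by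
  have h : HasDerivAt (fun s => ∑ i, x s i * y s i) (∑ i, (x' i * y t i + x t i * y' i)) t :=
    HasDerivAt.fun_sum fun i _ => (hasDerivAt_pi.1 hx i).mul (hasDerivAt_pi.1 hy i)
  rwa [Finset.sum_add_distrib] at h

theorem hasDerivAt_cross {x y : ℝ → Vec3} {x' y' : Vec3} {t : ℝ} (hx : HasDerivAt x x' t)
    (hy : HasDerivAt y y' t) :
    HasDerivAt (fun s => x s ⨯₃ y s) (x' ⨯₃ y t + x t ⨯₃ y') t := by
  have dx := hasDerivAt_pi.1 hx
  have dy := hasDerivAt_pi.1 hy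
  refine hasDerivAt_pi.2 fun i => ?_
  fin_cases i <;> simp only [cross_apply]
  · exact (((dx 1).mul (dy 2)).sub ((dx 2).mul (dy 1))).congr_deriv (by simp; ring)
  · exact (((dx 2).mul (dy 0)).sub ((dx 0).mul (dy 2))).congr_deriv (by simp; ring)
  · exact (((dx 0).mul (dy 1)).sub ((dx 1).mul (dy 0))).congr_deriv (by simp; ring)

theorem eq_of_hasDerivAt_zero {x : ℝ → Vec3} (h : ∀ t, HasDerivAt x 0 t) (s t : ℝ) :
    x s = x t :=
  is_const_of_deriv_eq_zero (fun t => (h t).differentiableAt) (fun t => (h t).deriv) s t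

/-- A curve with constant angular velocity `ω` is a rotation about `ω`: the distance of two
such curves is constant. -/
theorem eq_exp_mulVec_of_hasDerivAt {ω : Vec3} {y : ℝ → Vec3}
    (hy : ∀ t, HasDerivAt y (ω ⨯₃ y t) t) (t : ℝ) :
    y t = NormedSpace.exp (t • hat ω) *ᵥ y 0 := by
  set d : ℝ → Vec3 := fun s => y s - NormedSpace.exp (s • hat ω) *ᵥ y 0 with hd_def
  have hd : ∀ s, HasDerivAt d (ω ⨯₃ d s) s := fun s => by
    rw [hd_def, map_sub]
    exact (hy s).sub (hasDerivAt_exp_mulVec ω (y 0) s)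
  have hq : ∀ s, HasDerivAt (fun s => d s ⬝ᵥ d s) 0 s := fun s =>
    (hasDerivAt_dotProduct (hd s) (hd s)).congr_deriv (by
      rw [dotProduct_comm, dot_cross_self, add_zero])
  have hc : d t ⬝ᵥ d t = d 0 ⬝ᵥ d 0 :=
    is_const_of_deriv_eq_zero (fun t => (hq t).differentiableAt) (fun t => (hq t).deriv) t 0
  have h0 : d 0 = 0 := by simp [hd_def]
  rw [h0, dotProduct_zero, dotProduct_self_eq_zero] at hc
  exact sub_eq_zero.1 hc

theorem hasDerivAt_mat_mulVec {c : ℝ → Ambient} {u : Ambient} {x : ℝ → Vec3} {x' : Vec3} {t : ℝ}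
    (hc : HasDerivAt c u t) (hx : HasDerivAt x x' t) :
    HasDerivAt (fun s => mat (c s) *ᵥ x s) (mat u *ᵥ x t + mat (c t) *ᵥ x') t := by
  have h1 : HasDerivAt (fun s => (c s).1) u.1 t :=
    (ContinuousLinearMap.fst ℝ (Fin 3 → Fin 3 → ℝ) Vec3).hasFDerivAt.comp_hasDerivAt t hc
  refine hasDerivAt_pi.2 fun i => ?_
  have h : HasDerivAt (fun s => ∑ k, (c s).1 i k * x s k)
      (∑ k, (u.1 i k * x t k + (c t).1 i k * x' k)) t :=
    HasDerivAt.fun_sum fun k _ =>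
      (hasDerivAt_pi.1 (hasDerivAt_pi.1 h1 i) k).mul (hasDerivAt_pi.1 hx k)
  rw [Finset.sum_add_distrib] at h
  exact h

/-- The velocity of a curve in `T*SO(3)` is tangent to `T*SO(3)`. -/
theorem mem_tangent_of_hasDerivAt {c : ℝ → Ambient} {u : Ambient} {t : ℝ}
    (hc : HasDerivAt c u t) (hmem : ∀ s, c s ∈ TstarSO3) : u ∈ tangent (c t) := by
  have h1 : HasDerivAt (fun s => (c s).1) u.1 t :=
    (ContinuousLinearMap.fst ℝ (Fin 3 → Fin 3 → ℝ) Vec3).hasFDerivAt.comp_hasDerivAt t hc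
  have h2 : ∀ i j, HasDerivAt (fun s => (c s).1 i j) (u.1 i j) t := fun i j =>
    hasDerivAt_pi.1 (hasDerivAt_pi.1 h1 i) j
  change (mat (c t))ᵀ * mat u + (mat u)ᵀ * mat (c t) = 0
  ext i j
  have h : HasDerivAt (fun s => ∑ k, (c s).1 k i * (c s).1 k j)
      (∑ k, (u.1 k i * (c t).1 k j + (c t).1 k i * u.1 k j)) t :=
    HasDerivAt.fun_sum fun k _ => (h2 k i).mul (h2 k j)
  have e : (fun s => ∑ k, (c s).1 k i * (c s).1 k j) = fun _ => (1 : Mat3) i j := by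
    funext s
    rw [← transpose_mul_self_of_mem (hmem s)]
    rfl
  rw [e] at h
  have h0 := h.unique (hasDerivAt_const t _)
  rw [Finset.sum_add_distrib, add_comm] at h0
  exact h0

/-! ### States of the reduced system -/

section State

variable {R σ : ℝ}

theorem location_proj (p : level σ) : location R σ (proj σ p) = R • (mat p.1 *ᵥ kvec) := rfl

theorem momentum_proj (p : level σ) : momentum σ (proj σ p) = mat p.1 *ᵥ p.1.2 :=
  leftMomentum_of_mem p.2.1

theorem snd_two_of_level (p : level σ) : p.1.2 2 = -σ := by
  have h := p.2.2
  rw [torusMomentum_of_mem p.2.1] at h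
  linarith

theorem exists_proj_eq (z : ReducedSpace σ) : ∃ p : level σ, proj σ p = z :=
  Quotient.exists_rep z

theorem location_dotProduct_self (z : ReducedSpace σ) :
    location R σ z ⬝ᵥ location R σ z = R ^ 2 := by
  obtain ⟨p, rfl⟩ := exists_proj_eq z
  rw [location_proj, smul_dotProduct, dotProduct_smul, mulVec_dotProduct_mulVec p.2.1,
    dotProduct_kvec]
  simp [kvec, pow_two]

theorem momentum_dotProduct_location (z : ReducedSpace σ) :
    momentum σ z ⬝ᵥ location R σ z = -(R * σ) := by
  obtain ⟨p, rfl⟩ := exists_proj_eq z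
  rw [location_proj, momentum_proj, dotProduct_smul, mulVec_dotProduct_mulVec p.2.1,
    dotProduct_kvec, snd_two_of_level, smul_eq_mul, mul_neg]

/-- Location and momentum are coordinates on the reduced space: two frames with the same third
axis differ by an element of the torus. -/
theorem eq_of_location_eq_of_momentum_eq (hR : R ≠ 0) {z z' : ReducedSpace σ}
    (hl : location R σ z = location R σ z') (hm : momentum σ z = momentum σ z') : z = z' := by
  obtain ⟨p, rfl⟩ := exists_proj_eq z
  obtain ⟨q, rfl⟩ := exists_proj_eq z'
  have hp : mat p.1 ∈ Matrix.specialOrthogonalGroup (Fin 3) ℝ := p.2.1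
  have hq : mat q.1 ∈ Matrix.specialOrthogonalGroup (Fin 3) ℝ := q.2.1
  rw [location_proj, location_proj] at hl
  rw [momentum_proj, momentum_proj] at hm
  have hk : mat p.1 *ᵥ kvec = mat q.1 *ᵥ kvec := smul_right_injective _ hR hl
  have hM : (mat q.1)ᵀ * mat p.1 ∈ Matrix.specialOrthogonalGroup (Fin 3) ℝ :=
    mul_mem (transpose_mem hq) hp
  obtain ⟨θ, hθ⟩ := exists_eq_rotZ hM (by
    rw [← Matrix.mulVec_mulVec, hk, Matrix.mulVec_mulVec, transpose_mul_self_of_mem hq,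
      Matrix.one_mulVec])
  refine Quotient.sound ⟨θ, ?_⟩
  have h1 : mat p.1 * (rotZ θ)ᵀ = mat q.1 := by
    rw [← hθ, Matrix.transpose_mul, Matrix.transpose_transpose, ← Matrix.mul_assoc,
      mul_transpose_self_of_mem hp, Matrix.one_mul]
  have h2 : rotZ θ *ᵥ p.1.2 = q.1.2 := by
    rw [← hθ, ← Matrix.mulVec_mulVec, hm, Matrix.mulVec_mulVec, transpose_mul_self_of_mem hq,
      Matrix.one_mulVec]
  rw [torusAct, h1, h2]
  rfl

/-- The relation between location and momentum is the only one: any frame whose third axis points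
to `y` carries the state. -/
theorem exists_state (hR : R ≠ 0) {y μ : Vec3} (hy : y ⬝ᵥ y = R ^ 2) (hμ : μ ⬝ᵥ y = -(R * σ)) :
    ∃ z : ReducedSpace σ, location R σ z = y ∧ momentum σ z = μ := by
  obtain ⟨A, hA, hk⟩ := exists_mem_mulVec_kvec (n := (1 / R) • y) (by
    rw [smul_dotProduct, dotProduct_smul, hy, smul_eq_mul, smul_eq_mul]
    field_simp)
  have hp : pair A (Aᵀ *ᵥ μ) ∈ TstarSO3 := hA
  have hσ : torusMomentum (pair A (Aᵀ *ᵥ μ)) = σ := by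
    rw [torusMomentum_of_mem hp, ← dotProduct_kvec (pair A _).2]
    change -((Aᵀ *ᵥ μ) ⬝ᵥ kvec) = σ
    rw [← mulVec_dotProduct_mulVec hA, Matrix.mulVec_mulVec, mul_transpose_self_of_mem hA,
      Matrix.one_mulVec, hk, dotProduct_smul, hμ, smul_eq_mul]
    field_simp
  refine ⟨proj σ ⟨_, hp, hσ⟩, ?_, ?_⟩
  · rw [location_proj, mat_pair, hk, smul_smul, mul_one_div_cancel hR, one_smul]
  · rw [momentum_proj, mat_pair]
    change A *ᵥ (Aᵀ *ᵥ μ) = μ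
    rw [Matrix.mulVec_mulVec, mul_transpose_self_of_mem hA, Matrix.one_mulVec]

end State

/-! ### Trajectories of the reduced system -/

section Trajectory

variable {R σ ξ : ℝ} {J : Vec3} {γ : ℝ → ReducedSpace σ}

/-- The third axis of the frame rotates about the spatial momentum; the part of the angular
velocity along the axis itself, which the reduced equation leaves free, has no effect. -/
theorem hasDerivAt_mulVec_kvec {c : ℝ → Ambient} {u : Ambient} {η : Vec3} {a t : ℝ}
    (hc : HasDerivAt c u t) (hp : c t ∈ TstarSO3) (hu : mat u = mat (c t) * hat η)
    (hη : η ⨯₃ kvec = a • ((c t).2 ⨯₃ kvec)) :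
    HasDerivAt (fun s => mat (c s) *ᵥ kvec)
      ((a • (mat (c t) *ᵥ (c t).2)) ⨯₃ (mat (c t) *ᵥ kvec)) t := by
  refine (hasDerivAt_mat_mulVec hc (hasDerivAt_const t kvec)).congr_deriv ?_
  rw [hu, Matrix.mulVec_zero, add_zero, ← Matrix.mulVec_mulVec, hat_mulVec, hη,
    Matrix.mulVec_smul, mulVec_cross hp, map_smul, LinearMap.smul_apply]

/-- Conservation of the spatial momentum. -/
theorem hasDerivAt_mulVec_snd {c : ℝ → Ambient} {u : Ambient} {η : Vec3} {t : ℝ}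
    (hc : HasDerivAt c u t) (hu : mat u = mat (c t) * hat η) (hu2 : u.2 = (c t).2 ⨯₃ η) :
    HasDerivAt (fun s => mat (c s) *ᵥ (c s).2) 0 t := by
  have h2 : HasDerivAt (fun s => (c s).2) u.2 t :=
    (ContinuousLinearMap.snd ℝ (Fin 3 → Fin 3 → ℝ) Vec3).hasFDerivAt.comp_hasDerivAt t hc
  refine (hasDerivAt_mat_mulVec hc h2).congr_deriv ?_
  rw [hu, ← Matrix.mulVec_mulVec, hat_mulVec, hu2, ← Matrix.mulVec_add, cross_anticomm',
    Matrix.mulVec_zero]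

theorem IsReducedTrajectory.hasDerivAt (hJ : J 0 = J 1)
    (hγ : IsReducedTrajectory (driftHamiltonian (ξ • kvec) (Matrix.diagonal J)) σ γ) (t : ℝ) :
    HasDerivAt (fun s => location R σ (γ s))
      ((J 0 • momentum σ (γ t)) ⨯₃ location R σ (γ t)) t ∧
    HasDerivAt (fun s => momentum σ (γ s)) 0 t := by
  obtain ⟨c, hc, hd, hω⟩ := hγ
  have hu := (hd t).hasDerivAt
  have hω := hω t
  have hp : (c t : Ambient) ∈ TstarSO3 := (c t).2.1
  have hu' := mem_tangent_of_hasDerivAt hu fun s => (c s).2.1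
  obtain ⟨η, e⟩ := exists_eq_pair_of_mem_tangent hp hu'
  rw [e] at hω
  have hh := (hamilton_iff hJ hp η _).1 hω
  have hm : mat (deriv (fun s => (c s : Ambient)) t) = mat (c t : Ambient) * hat η :=
    congrArg mat e
  have h1 := (hasDerivAt_mulVec_kvec hu hp hm hh.1).const_smul R
  have h2 := hasDerivAt_mulVec_snd hu hm hh.2
  simp only [← hc, location_proj, momentum_proj]
  refine ⟨?_, h2⟩
  rw [map_smul]
  exact h1

theorem IsReducedTrajectory.momentum_eq (hJ : J 0 = J 1)
    (hγ : IsReducedTrajectory (driftHamiltonian (ξ • kvec) (Matrix.diagonal J)) σ γ) (t : ℝ) :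
    momentum σ (γ t) = momentum σ (γ 0) :=
  eq_of_hasDerivAt_zero (fun t => (hγ.hasDerivAt (R := 1) hJ t).2) t 0

theorem IsReducedTrajectory.hasDerivAt_location (hJ : J 0 = J 1)
    (hγ : IsReducedTrajectory (driftHamiltonian (ξ • kvec) (Matrix.diagonal J)) σ γ) (t : ℝ) :
    HasDerivAt (fun s => location R σ (γ s))
      ((J 0 • momentum σ (γ 0)) ⨯₃ location R σ (γ t)) t := by
  rw [← hγ.momentum_eq hJ t]
  exact (hγ.hasDerivAt hJ t).1

theorem IsReducedTrajectory.location_eq (hJ : J 0 = J 1)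
    (hγ : IsReducedTrajectory (driftHamiltonian (ξ • kvec) (Matrix.diagonal J)) σ γ) (t : ℝ) :
    location R σ (γ t) =
      NormedSpace.exp (t • hat (J 0 • momentum σ (γ 0))) *ᵥ location R σ (γ 0) :=
  eq_exp_mulVec_of_hasDerivAt (fun s => hγ.hasDerivAt_location hJ s) t

/-- Through every state there is a trajectory: rotate the frame about the momentum, and keep the
momentum in the body frame. -/
theorem exists_isReducedTrajectory (hJ : J 0 = J 1) (z : ReducedSpace σ) :
    ∃ γ : ℝ → ReducedSpace σ,
      IsReducedTrajectory (driftHamiltonian (ξ • kvec) (Matrix.diagonal J)) σ γ ∧ γ 0 = z := by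
  obtain ⟨p, rfl⟩ := exists_proj_eq z
  have hA : mat p.1 ∈ Matrix.specialOrthogonalGroup (Fin 3) ℝ := p.2.1
  set π : Vec3 := p.1.2 with hπ
  set ω : Vec3 := J 0 • (mat p.1 *ᵥ π) with hω
  set c : ℝ → Ambient := fun t => pair (NormedSpace.exp (t • hat ω) * mat p.1) π with hc
  have hexp : ∀ t : ℝ, NormedSpace.exp (t • hat ω) ∈ Matrix.specialOrthogonalGroup (Fin 3) ℝ :=
    fun t => by rw [smul_hat]; exact exp_hat_mem _
  have hmem : ∀ t, c t ∈ TstarSO3 := fun t => mul_mem (hexp t) hA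
  have hlev : ∀ t, c t ∈ level σ := fun t => ⟨hmem t, by
    rw [torusMomentum_of_mem (hmem t)]
    change -(p.1.2 2) = σ
    rw [snd_two_of_level, neg_neg]⟩
  -- the spatial momentum is on the rotation axis, so it stays fixed
  have hfix : ∀ t : ℝ, NormedSpace.exp (t • hat ω) *ᵥ ω = ω := fun t => by
    have h := eq_exp_mulVec_of_hasDerivAt (ω := ω) (y := fun _ => ω) (fun s => by
      rw [cross_self]; exact hasDerivAt_const s ω) t
    exact h.symm
  have hder : ∀ t, HasDerivAt c (pair (mat (c t) * hat (J 0 • π)) 0) t := fun t => by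
    have hb : mat (c t) * hat (J 0 • π) =
        hat ω * NormedSpace.exp (t • hat ω) * mat p.1 := by
      have h1 : mat (c t) *ᵥ (J 0 • π) = ω := by
        rw [hc, mat_pair, ← Matrix.mulVec_mulVec, Matrix.mulVec_smul, ← hω, hfix]
      have h2 : J 0 • π = (mat (c t))ᵀ *ᵥ ω := by
        rw [← h1, Matrix.mulVec_mulVec, transpose_mul_self_of_mem (hmem t), Matrix.one_mulVec]
      rw [h2, ← hat_mul_of_mem (hmem t), Matrix.mul_assoc]
      rfl
    rw [hb]
    refine HasDerivAt.prodMk ?_ (hasDerivAt_const t π)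
    refine hasDerivAt_pi.2 fun i => hasDerivAt_pi.2 fun j => ?_
    have h : HasDerivAt (fun s : ℝ => ∑ k, NormedSpace.exp (s • hat ω) i k * mat p.1 k j)
        (∑ k, (hat ω * NormedSpace.exp (t • hat ω)) i k * mat p.1 k j) t :=
      HasDerivAt.fun_sum fun k _ => (hasDerivAt_exp_smul_apply _ i k t).mul_const _
    exact h
  refine ⟨fun t => proj σ ⟨c t, hlev t⟩, ⟨fun t => ⟨c t, hlev t⟩, fun t => rfl,
    fun t => (hder t).differentiableAt, fun t => ?_⟩, ?_⟩
  · change ∀ w ∈ levelTangent (c t), omega (c t) (deriv c t) w = _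
    rw [(hder t).deriv]
    refine (hamilton_iff hJ (hmem t) _ _).2 ⟨?_, ?_⟩
    · rw [map_smul, LinearMap.smul_apply]
      rfl
    · rw [map_smul]
      change 0 = J 0 • (π ⨯₃ π)
      rw [cross_self, smul_zero]
  · refine congrArg (proj σ) (Subtype.ext ?_)
    change c 0 = p.1
    rw [hc]
    simp only [zero_smul, NormedSpace.exp_zero, Matrix.one_mul]
    rfl

/-- Uniqueness: the reduced equation leaves the lift free along the torus, but determines location
and momentum, which are coordinates on the reduced space. -/
theorem IsReducedTrajectory.ext (hR : R ≠ 0) (hJ : J 0 = J 1) {γ' : ℝ → ReducedSpace σ}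
    (hγ : IsReducedTrajectory (driftHamiltonian (ξ • kvec) (Matrix.diagonal J)) σ γ)
    (hγ' : IsReducedTrajectory (driftHamiltonian (ξ • kvec) (Matrix.diagonal J)) σ γ')
    (h : γ 0 = γ' 0) : γ = γ' := by
  funext t
  apply eq_of_location_eq_of_momentum_eq hR
  · rw [hγ.location_eq hJ, hγ'.location_eq hJ, h]
  · rw [hγ.momentum_eq hJ, hγ'.momentum_eq hJ, h]

end Trajectory

/-! ### The charged particle -/

section Particle

variable {R σ m j : ℝ}

/-- On the sphere, the component of the momentum normal to `y` is fixed by the charge, and the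
tangential component by the velocity. -/
theorem momentum_eq_of_velocity (hR : R ≠ 0) (hj : j ≠ 0) (hm : m = -(1 / (j * R ^ 2)))
    {y v μ : Vec3} (hy : y ⬝ᵥ y = R ^ 2) (hμ : μ ⬝ᵥ y = -(R * σ)) (hv : v = (j • μ) ⨯₃ y) :
    μ = -(m • (y ⨯₃ v)) - (σ / R) • y := by
  have h : y ⨯₃ (μ ⨯₃ y) = R ^ 2 • μ + (R * σ) • y := by
    rw [cross_cross_eq_smul_sub_smul', hy, hμ, neg_smul, sub_neg_eq_add]
  rw [hv, map_smul, LinearMap.smul_apply, map_smul, h, hm]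
  ext i
  simp only [Pi.neg_apply, Pi.add_apply, Pi.sub_apply, Pi.smul_apply, smul_eq_mul]
  field_simp
  ring

/-- A point of the sphere in uniform rotation about `μ` moves as the charged particle. -/
theorem isMonopoleMotion_of_hasDerivAt (hR : R ≠ 0) (hj : j ≠ 0) (hm : m = -(1 / (j * R ^ 2)))
    {y : ℝ → Vec3} {μ : Vec3} (hy : ∀ t, y t ⬝ᵥ y t = R ^ 2) (hμ : ∀ t, μ ⬝ᵥ y t = -(R * σ))
    (hd : ∀ t, HasDerivAt y ((j • μ) ⨯₃ y t) t) : IsMonopoleMotion m σ R y := by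
  refine ⟨hy, fun t => (j • μ) ⨯₃ y t, fun t => (j • μ) ⨯₃ ((j • μ) ⨯₃ y t), hd, fun t => ?_,
    fun t => ?_⟩
  · exact (hasDerivAt_cross (hasDerivAt_const t (j • μ)) (hd t)).congr_deriv (by simp)
  · obtain ⟨v, hv⟩ : ∃ v, v = (j • μ) ⨯₃ y t := ⟨_, rfl⟩
    have e := momentum_eq_of_velocity hR hj hm (hy t) (hμ t) hv
    have h0 : y t ⬝ᵥ v = 0 := by rw [hv, dot_cross_self]
    have h : μ ⨯₃ v = (m * (v ⬝ᵥ v)) • y t - (σ / R) • (y t ⨯₃ v) := by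
      rw [e]
      simp only [map_sub, map_neg, map_smul, LinearMap.sub_apply, LinearMap.neg_apply,
        LinearMap.smul_apply]
      rw [cross_cross_eq_smul_sub_smul, h0, zero_smul, zero_sub, smul_neg, neg_neg, smul_smul]
    have hmj : m * j = -(1 / R ^ 2) := by
      rw [hm]; field_simp
    beta_reduce
    rw [← hv, map_smul, LinearMap.smul_apply, smul_smul, hmj, h, monopoleField, map_smul,
      LinearMap.smul_apply]
    ext i
    simp only [Pi.neg_apply, Pi.add_apply, Pi.sub_apply, Pi.smul_apply, smul_eq_mul]
    field_simp
    ring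

/-- The charged particle conserves the sum of its angular momentum `m • (y ⨯₃ v)` and the angular
momentum `(σ / R) • y` of the field; `-μ` is that sum, and the motion is a uniform rotation about
it. -/
theorem IsMonopoleMotion.exists_hasDerivAt (hR : R ≠ 0) (hj : j ≠ 0)
    (hm : m = -(1 / (j * R ^ 2))) {y : ℝ → Vec3} (h : IsMonopoleMotion m σ R y) :
    ∃ μ : Vec3, μ ⬝ᵥ y 0 = -(R * σ) ∧ ∀ t, HasDerivAt y ((j • μ) ⨯₃ y t) t := by
  obtain ⟨hy, v, a, hv, ha, he⟩ := h
  have h0 : ∀ t, y t ⬝ᵥ v t = 0 := fun t => by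
    have h1 := hasDerivAt_dotProduct (hv t) (hv t)
    rw [funext hy] at h1
    have h2 := h1.unique (hasDerivAt_const t _)
    rw [dotProduct_comm (v t)] at h2
    linarith
  -- the momentum that the velocity and the charge prescribe
  set μ : ℝ → Vec3 := fun t => -(m • (y t ⨯₃ v t)) - (σ / R) • y t with hμ
  have hd : ∀ t, HasDerivAt μ 0 t := fun t => by
    have h1 := (((hasDerivAt_cross (hv t) (ha t)).const_smul m).neg).sub
      ((hv t).const_smul (σ / R))
    refine h1.congr_deriv ?_
    have e : m • (y t ⨯₃ a t) = -((σ / R) • v t) := by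
      rw [← map_smul, he t, monopoleField]
      simp only [map_add, map_neg, map_smul, LinearMap.smul_apply, cross_self, smul_zero,
        neg_zero, zero_add]
      rw [cross_cross_eq_smul_sub_smul', h0, hy, zero_smul, zero_sub, smul_neg, smul_neg,
        smul_smul, smul_smul]
      congr 2
      field_simp
    rw [cross_self, zero_add, e, neg_neg, sub_self]
  have hc : ∀ t, μ t = μ 0 := fun t => eq_of_hasDerivAt_zero hd t 0
  refine ⟨μ 0, ?_, fun t => (hv t).congr_deriv ?_⟩
  · rw [hμ]
    simp only [sub_dotProduct, neg_dotProduct, smul_dotProduct, hy, smul_eq_mul]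
    rw [dotProduct_comm, dot_self_cross]
    field_simp
    ring
  · rw [← hc t, hμ]
    simp only [map_sub, map_neg, map_smul, LinearMap.sub_apply, LinearMap.neg_apply,
      LinearMap.smul_apply, cross_self, smul_zero, sub_zero]
    rw [cross_cross_eq_smul_sub_smul, hy, dotProduct_comm, h0, zero_smul, sub_zero, smul_neg,
      smul_smul, smul_smul, hm, ← neg_smul]
    rw [show -(j * -(1 / (j * R ^ 2)) * R ^ 2) = 1 by field_simp, one_smul]

end Particle

/-! ### The vortex data and the symmetry of the Hamiltonian -/

theorem J3_ne_zero {R α : ℝ} (hR : R ≠ 0) (hα : Real.cos α ≠ 0) : J3 R α 0 ≠ 0 := by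
  simp [J3, hR, hα, Real.pi_ne_zero]

theorem J4_ne_zero {R α : ℝ} (hR : R ≠ 0) (h0 : 0 < α) (hπ : α < Real.pi) : J4 R α 0 ≠ 0 := by
  have hc : 1 - Real.cos α ≠ 0 := by
    have := Real.cos_lt_cos_of_nonneg_of_le_pi le_rfl hπ.le h0
    rw [Real.cos_zero] at this
    linarith
  have h1 : 3 * Real.cos α ^ 2 + Real.cos α + 2 ≠ 0 := by
    nlinarith [sq_nonneg (Real.cos α), sq_nonneg (Real.cos α + 1)]
  have h2 : 9 * Real.cos α ^ 2 + 4 * Real.cos α + 3 ≠ 0 := by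
    nlinarith [sq_nonneg (Real.cos α), sq_nonneg (Real.cos α + 1)]
  have hp := Real.pi_ne_zero
  simp [J4, hR, hc, h1, h2, hp]

theorem driftHamiltonian_torusAct (ξ : ℝ) {J : Vec3} (hJ : J 0 = J 1) (θ : ℝ) (p : Ambient) :
    driftHamiltonian (ξ • kvec) (Matrix.diagonal J) (torusAct θ p) =
      driftHamiltonian (ξ • kvec) (Matrix.diagonal J) p := by
  have h := Real.sin_sq_add_cos_sq θ
  simp [driftHamiltonian, torusAct, pair, rotZ, kvec, dotProduct, Fin.sum_univ_three,
    Matrix.mulVec, Matrix.diagonal, ← hJ]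
  linear_combination (J 0 * (p.2 0 ^ 2 + p.2 1 ^ 2)) * h

end DriftSystem

theorem mainTheorem4 (R : ℝ) (hR : 0 < R) :
    -- the three and four vortex data satisfy the hypotheses below
    (∀ α : ℝ, 0 < α → α < Real.pi → Real.cos α ≠ 0 →
      ∀ J : Vec3, J = J3 R α ∨ J = J4 R α → J 0 = J 1 ∧ J 0 ≠ 0) ∧
    ∀ (ξ : ℝ) (J : Vec3), J 0 = J 1 → J 0 ≠ 0 →
      -- the drift Hamiltonian and the mass
      ∀ (H : Ambient → ℝ) (m : ℝ),
        H = driftHamiltonian (ξ • kvec) (Matrix.diagonal J) → m = -(1 / (J 0 * R ^ 2)) →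
      -- the torus action is a symmetry
      (∀ (θ : ℝ) (p : Ambient), H (torusAct θ p) = H p) ∧
      -- for every charge: the reduced system, and its identification with the charged particle
      (∀ σ : ℝ,
        (∀ z : ReducedSpace σ, ∃! γ : ℝ → ReducedSpace σ, IsReducedTrajectory H σ γ ∧ γ 0 = z) ∧
        Set.BijOn (fun (γ : ℝ → ReducedSpace σ) (t : ℝ) => location R σ (γ t))
          {γ | IsReducedTrajectory H σ γ} {y | IsMonopoleMotion m σ R y} ∧
        -- the motion is the rotation about `Δμ` with angular velocity `J 0 • Δμ`
        ∀ (γ : ℝ → ReducedSpace σ) (Δμ : Vec3), IsReducedTrajectory H σ γ →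
          momentum σ (γ 0) = Δμ →
          (∀ t, momentum σ (γ t) = Δμ) ∧
          (∀ t, location R σ (γ t) =
            NormedSpace.exp (t • hat (J 0 • Δμ)) *ᵥ location R σ (γ 0)) ∧
          (location R σ (γ 0) = R • kvec →
            σ = -(Δμ ⬝ᵥ kvec) ∧
            HasDerivAt (fun t => location R σ (γ t))
              ((1 / (m * R ^ 2)) • (location R σ (γ 0) ⨯₃ Δμ)) 0)) ∧
      -- every momentum perturbation at the location `R k` is a state of the reduced system
      (∀ Δμ : Vec3, ∃! z : ReducedSpace (-(Δμ ⬝ᵥ kvec)),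
        location R (-(Δμ ⬝ᵥ kvec)) z = R • kvec ∧ momentum (-(Δμ ⬝ᵥ kvec)) z = Δμ) := by
  refine ⟨?_, ?_⟩
  · rintro α h0 hπ hα J (rfl | rfl)
    · exact ⟨rfl, J3_ne_zero hR.ne' hα⟩
    · exact ⟨rfl, J4_ne_zero hR.ne' h0 hπ⟩
  rintro ξ J hJ hJ0 H m rfl hm
  refine ⟨driftHamiltonian_torusAct ξ hJ, fun σ => ⟨fun z => ?_, ⟨?_, ?_, ?_⟩, ?_⟩, fun Δμ => ?_⟩
  · obtain ⟨γ, hγ, h0⟩ := exists_isReducedTrajectory (ξ := ξ) hJ z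
    exact ⟨γ, ⟨hγ, h0⟩, fun γ' h' => h'.1.ext hR.ne' hJ hγ (h'.2.trans h0.symm)⟩
  · intro γ (hγ : IsReducedTrajectory _ σ γ)
    exact isMonopoleMotion_of_hasDerivAt (j := J 0) (μ := momentum σ (γ 0)) hR.ne' hJ0 hm
      (fun t => location_dotProduct_self _)
      (fun t => by rw [← hγ.momentum_eq hJ t]; exact momentum_dotProduct_location _)
      (fun t => hγ.hasDerivAt_location hJ t)
  · intro γ (hγ : IsReducedTrajectory _ σ γ) γ' (hγ' : IsReducedTrajectory _ σ γ')
      (h : (fun t => location R σ (γ t)) = fun t => location R σ (γ' t))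
    have h0 : location R σ (γ 0) = location R σ (γ' 0) := congrFun h 0
    refine hγ.ext hR.ne' hJ hγ' (eq_of_location_eq_of_momentum_eq hR.ne' h0 ?_)
    -- the same motion has the same velocity, which determines the momentum
    have hd := hγ.hasDerivAt_location (R := R) hJ 0
    rw [h] at hd
    have hv := hd.unique (hγ'.hasDerivAt_location hJ 0)
    rw [momentum_eq_of_velocity hR.ne' hJ0 hm (location_dotProduct_self (γ 0))
      (momentum_dotProduct_location (γ 0)) rfl, hv, h0]
    exact (momentum_eq_of_velocity hR.ne' hJ0 hm (location_dotProduct_self (γ' 0))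
      (momentum_dotProduct_location (γ' 0)) rfl).symm
  · intro y (hy : IsMonopoleMotion m σ R y)
    obtain ⟨μ, hμ, hd⟩ := hy.exists_hasDerivAt hR.ne' hJ0 hm
    obtain ⟨z, hz, hzμ⟩ := exists_state hR.ne' (hy.1 0) hμ
    obtain ⟨γ, hγ, rfl⟩ := exists_isReducedTrajectory (ξ := ξ) hJ z
    refine ⟨γ, hγ, funext fun t => ?_⟩
    change location R σ (γ t) = y t
    rw [hγ.location_eq hJ, hzμ, hz, ← eq_exp_mulVec_of_hasDerivAt hd]
  · rintro γ _ hγ rfl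
    refine ⟨hγ.momentum_eq hJ, hγ.location_eq hJ, fun h0 => ⟨?_, ?_⟩⟩
    · have h := momentum_dotProduct_location (R := R) (γ 0)
      rw [h0, dotProduct_smul, smul_eq_mul, ← mul_neg] at h
      rw [mul_left_cancel₀ hR.ne' h, neg_neg]
    · refine (hγ.hasDerivAt_location hJ 0).congr_deriv ?_
      have e : 1 / (m * R ^ 2) = -J 0 := by
        have := hR.ne'
        rw [hm]; field_simp
      rw [e, neg_smul, ← smul_neg, cross_anticomm, map_smul, LinearMap.smul_apply]
  · obtain ⟨z, hz, hzμ⟩ := exists_state (R := R) (σ := -(Δμ ⬝ᵥ kvec)) (y := R • kvec) (μ := Δμ)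
      hR.ne' (by simp [kvec, dotProduct, Fin.sum_univ_three, pow_two])
      (by rw [dotProduct_smul, smul_eq_mul, mul_neg, neg_neg])
    exact ⟨z, ⟨hz, hzμ⟩, fun z' h' =>
      eq_of_location_eq_of_momentum_eq hR.ne' (h'.1.trans hz.symm) (h'.2.trans hzμ.symm)⟩
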